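/- **Theorem (Density Theorem).** Let $d\in\mathbb{N}$, let $g\in L^2(\mathbb{R}^d)$, and let $\Lambda=M\mathbb{Z}^{2d}\subset\mathbb{R}^{2d}$, $M\in GL(\mathbb{R},2d)$, be a (full-rank) lattice, with volume $\mathrm{vol}(\Lambda)=|\det M|$. For $\lambda=(x,\omega)\in\mathbb{R}^d\times\mathbb{R}^d$ let $\pi(\lambda)g(t)=e^{2\pi i\,\omega\cdot t}\,g(t-x)$. If the Gabor system $\mathcal G(g,\Lambda)=\{\pi(\lambda)g\mid\lambda\in\Lambda\}$ is a frame for $L^2(\mathbb{R}^d)$, i.e. there are constants $0<A\le B<\infty$ such that $$A\,\|f\|_2^2\le\sum_{\lambda\in\Lambda}|\langle f,\pi(\lambda)g\rangle|^2\le B\,\|f\|_2^2\qquad\text{for all } f\in L^2(\mathbb{R}^d),$$ then $\mathrm{vol}(\Lambda)\le 1$. -/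

import Mathlib

open MeasureTheory

noncomputable section

/-- The time-frequency plane `ℝ^{2d} = ℝ^d × ℝ^d`, with points `(x, ω)`. -/
abbrev PhaseSpace (d : ℕ) : Type :=
  EuclideanSpace ℝ (Fin d) × EuclideanSpace ℝ (Fin d)

/-- The Hilbert space `L²(ℝ^d)` of complex-valued functions, with respect to Lebesgue measure. -/
abbrev L2Space (d : ℕ) : Type :=
  Lp ℂ 2 (volume : Measure (EuclideanSpace ℝ (Fin d)))

/-- The translation (time shift) `T_x f (t) = f (t - x)`. -/
def translation {d : ℕ} (x : EuclideanSpace ℝ (Fin d)) (f : L2Space d) : L2Space d :=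
  Lp.compMeasurePreserving (fun t : EuclideanSpace ℝ (Fin d) => t - x)
    (measurePreserving_sub_right volume x) f

theorem memLp_modulation {d : ℕ} (ω : EuclideanSpace ℝ (Fin d)) (f : L2Space d) :
    MemLp (fun t : EuclideanSpace ℝ (Fin d) =>
      Complex.exp (2 * Real.pi * Complex.I * (inner ℝ ω t : ℝ)) * f t) 2 volume := by
  refine (Lp.memLp f).of_le ?_ (Filter.Eventually.of_forall fun t => ?_)
  · exact (Continuous.aestronglyMeasurable (by fun_prop)).mul (Lp.aestronglyMeasurable f)
  · simp [Complex.norm_exp]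

/-- The modulation (frequency shift) `M_ω f (t) = e^{2πi ω·t} f (t)`. -/
def modulation {d : ℕ} (ω : EuclideanSpace ℝ (Fin d)) (f : L2Space d) : L2Space d :=
  (memLp_modulation ω f).toLp

/-- The time-frequency shift `π(x, ω) = M_ω T_x`. -/
def timeFreqShift {d : ℕ} (z : PhaseSpace d) (f : L2Space d) : L2Space d :=
  modulation z.2 (translation z.1 f)

/-- A family `e` in a complex Hilbert space is a frame: there are constants `0 < A ≤ B < ∞` with
`A ‖f‖² ≤ ∑ |⟨f, e γ⟩|² ≤ B ‖f‖²` for all `f`. The upper inequality includes convergence of the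
series, which is stated explicitly. -/
def IsFrame {ι H : Type*} [NormedAddCommGroup H] [InnerProductSpace ℂ H] (e : ι → H) : Prop :=
  ∃ A B : ℝ, 0 < A ∧ A ≤ B ∧ ∀ f : H,
    Summable (fun γ => ‖(inner ℂ (e γ) f : ℂ)‖ ^ 2) ∧
    A * ‖f‖ ^ 2 ≤ ∑' γ, ‖(inner ℂ (e γ) f : ℂ)‖ ^ 2 ∧
    ∑' γ, ‖(inner ℂ (e γ) f : ℂ)‖ ^ 2 ≤ B * ‖f‖ ^ 2

/-- The Gabor system `𝒢(g, Γ) = {π(γ) g | γ ∈ Γ}`, as a family indexed by `Γ`. -/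
def gaborSystem {d : ℕ} (g : L2Space d) (Γ : Set (PhaseSpace d)) : Γ → L2Space d :=
  fun γ => timeFreqShift (γ : PhaseSpace d) g

end

/-! Pass to the canonical tight window `h = S^(-1/2) g`, where `S` is the frame operator. Since `Λ`
is a group, `S` commutes with `π(λ)` for `λ ∈ Λ`, so the `π(λ) h` form a Parseval frame
(`IsFrame.exists_tightening`). The term `λ = 0` of the Parseval identity at `h` gives `‖h‖⁴ ≤ ‖h‖²`,
so `‖h‖ ≤ 1`. On the other hand, Moyal's identity (`lintegral_enorm_inner_timeFreqShift_sq`) says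
that `|⟨f, π(z)h⟩|²` has integral `‖h‖²‖f‖²` over phase space. Folded onto a fundamental domain `F`,
the integrand becomes a lattice sum equal to `‖f‖²` at every point. Hence `vol(F) = ‖h‖² ≤ 1`. -/

/-! ### Frame operators and tight frames. -/

theorem exists_frameOperator {ι H : Type*} [NormedAddCommGroup H] [InnerProductSpace ℂ H]
    [CompleteSpace H] {e : ι → H} (he : IsFrame e) :
    ∃ S : H →L[ℂ] H, IsStrictlyPositive S ∧
      ∀ f, inner ℂ (S f) f = ((∑' γ, ‖(inner ℂ (e γ) f : ℂ)‖ ^ 2 : ℝ) : ℂ) := by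
  obtain ⟨A, B, hA, hAB, h⟩ := he
  have hmem (f : H) : Memℓp (fun γ => (inner ℂ (e γ) f : ℂ)) 2 :=
    memℓp_gen (by simpa using (h f).1)
  let C₀ : H →ₗ[ℂ] lp (fun _ : ι => ℂ) 2 :=
    { toFun := fun f => ⟨fun γ => (inner ℂ (e γ) f : ℂ), hmem f⟩
      map_add' := fun f f' => by ext γ; exact inner_add_right _ _ _
      map_smul' := fun c f => by ext γ; exact inner_smul_right _ _ _ }
  have hC₀ (f : H) : ‖C₀ f‖ ^ 2 = ∑' γ, ‖(inner ℂ (e γ) f : ℂ)‖ ^ 2 := by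
    have := lp.norm_rpow_eq_tsum (p := 2) (by norm_num) (C₀ f)
    simpa [C₀] using this
  let C : H →L[ℂ] lp (fun _ : ι => ℂ) 2 := C₀.mkContinuous (Real.sqrt B) fun f => by
    refine le_of_sq_le_sq ?_ (by positivity)
    rw [mul_pow, Real.sq_sqrt (hA.le.trans hAB), hC₀]
    exact (h f).2.2
  have hS (f : H) : inner ℂ ((ContinuousLinearMap.adjoint C ∘L C) f) f =
      ((∑' γ, ‖(inner ℂ (e γ) f : ℂ)‖ ^ 2 : ℝ) : ℂ) := by
    rw [← hC₀, ContinuousLinearMap.comp_apply, ContinuousLinearMap.adjoint_inner_left,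
      inner_self_eq_norm_sq_to_K]
    simp [C]
  refine ⟨_, ?_, hS⟩
  -- The lower frame bound makes the positive operator `C*C` invertible.
  have hle : algebraMap ℝ (H →L[ℂ] H) A ≤ ContinuousLinearMap.adjoint C ∘L C := by
    rw [ContinuousLinearMap.le_def, ContinuousLinearMap.isPositive_iff_complex]
    intro f
    have key : inner ℂ ((ContinuousLinearMap.adjoint C ∘L C - algebraMap ℝ (H →L[ℂ] H) A) f) f =
        ((∑' γ, ‖(inner ℂ (e γ) f : ℂ)‖ ^ 2 - A * ‖f‖ ^ 2 : ℝ) : ℂ) := by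
      have h2 : (algebraMap ℝ (H →L[ℂ] H) A) f = (A : ℂ) • f := by
        rw [Algebra.algebraMap_eq_smul_one]
        exact (Complex.coe_smul A f).symm
      rw [sub_apply, inner_sub_left, hS, h2, inner_smul_left,
        inner_self_eq_norm_sq_to_K]
      simp
    rw [key]
    exact ⟨rfl, sub_nonneg.2 (h f).2.1⟩
  have hpos : (0 : H →L[ℂ] H) ≤ algebraMap ℝ (H →L[ℂ] H) A := algebraMap_nonneg _ hA.le
  exact IsStrictlyPositive.of_le ⟨hpos, (IsUnit.mk0 A hA.ne').map _⟩ hle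

/-- If `e` is a frame with frame operator `S`, then `R = S ^ (-1/2)` turns `e` into a tight frame
with constant `1`, and it commutes with every isometry that preserves the frame quadratic form. -/
theorem IsFrame.exists_tightening {ι H : Type*} [NormedAddCommGroup H] [InnerProductSpace ℂ H]
    [CompleteSpace H] {e : ι → H} (he : IsFrame e) :
    ∃ R : H →L[ℂ] H,
      (∀ f, HasSum (fun γ => ‖(inner ℂ (R (e γ)) f : ℂ)‖ ^ 2) (‖f‖ ^ 2)) ∧
      ∀ U : H ≃ₗᵢ[ℂ] H, (∀ f, ∑' γ, ‖(inner ℂ (e γ) (U f) : ℂ)‖ ^ 2 =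
        ∑' γ, ‖(inner ℂ (e γ) f : ℂ)‖ ^ 2) → ∀ f, R (U f) = U (R f) := by
  obtain ⟨S, hpos, hS⟩ := exists_frameOperator he
  have hR : IsSelfAdjoint (S ^ (-(1 / 2) : ℝ)) := .of_nonneg CFC.rpow_nonneg
  have hsymm (f f' : H) : (inner ℂ ((S ^ (-(1 / 2) : ℝ)) f) f' : ℂ) =
      inner ℂ f ((S ^ (-(1 / 2) : ℝ)) f') :=
    (ContinuousLinearMap.isSelfAdjoint_iff_isSymmetric.1 hR) f f'
  refine ⟨S ^ (-(1 / 2) : ℝ), fun f => ?_, fun U hU => ?_⟩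
  · have hsum : Summable fun γ => ‖(inner ℂ ((S ^ (-(1 / 2) : ℝ)) (e γ)) f : ℂ)‖ ^ 2 := by
      obtain ⟨A, B, -, -, h⟩ := he
      simpa only [hsymm] using (h _).1
    have hconj := congrArg (fun T : H →L[ℂ] H => T f) (CFC.conjugate_rpow_neg_one_half S hpos)
    have := hS ((S ^ (-(1 / 2) : ℝ)) f)
    rw [← hsymm] at this
    change (inner ℂ ((S ^ (-(1 / 2) : ℝ) * S * S ^ (-(1 / 2) : ℝ)) f) f : ℂ) = _ at this
    rw [hconj] at this
    change (inner ℂ f f : ℂ) = _ at this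
    rw [inner_self_eq_norm_sq_to_K] at this
    have h2 : ‖f‖ ^ 2 = ∑' γ, ‖(inner ℂ (e γ) ((S ^ (-(1 / 2) : ℝ)) f) : ℂ)‖ ^ 2 := by
      exact Complex.ofReal_injective ((Complex.ofReal_pow _ _).trans this)
    rw [h2]
    simp only [← hsymm]
    exact hsum.hasSum
  -- `U⁻¹SU` and `S` have the same quadratic form, so they agree by polarization; functional
  -- calculus then carries the commutation to `S^(-1/2)`.
  · have hcomm : Commute S (U : H →L[ℂ] H) := by
      have hconj : (U.symm : H →L[ℂ] H) ∘L S ∘L (U : H →L[ℂ] H) = S := by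
        refine ContinuousLinearMap.coe_injective ((ext_inner_map _ _).1 fun f => ?_)
        change (inner ℂ (U.symm (S (U f))) f : ℂ) = inner ℂ (S f) f
        rw [hS, ← hU, ← hS, ← U.inner_map_map, U.apply_symm_apply]
      ext f
      have := congrArg (fun T : H →L[ℂ] H => U (T f)) hconj
      simpa using this
    intro f
    exact congrArg (fun T : H →L[ℂ] H => T f) (hcomm.cfc_nnreal (fun x => x ^ (-(1 / 2) : ℝ))).eq

/-! ### Time-frequency shifts as a projective unitary representation. -/

theorem coeFn_timeFreqShift {d : ℕ} (z : PhaseSpace d) (f : L2Space d) :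
    timeFreqShift z f =ᵐ[volume] fun t =>
      Complex.exp (2 * Real.pi * Complex.I * (inner ℝ z.2 t : ℝ)) * f (t - z.1) := by
  have h1 : timeFreqShift z f =ᵐ[volume] _ := (memLp_modulation z.2 (translation z.1 f)).coeFn_toLp
  have h2 := Lp.coeFn_compMeasurePreserving f (measurePreserving_sub_right volume z.1)
  filter_upwards [h1, h2] with t ht1 ht2
  rw [ht1, translation, ht2, Function.comp_apply]

theorem ae_comp_sub_right {d : ℕ} (x : EuclideanSpace ℝ (Fin d))
    {p : EuclideanSpace ℝ (Fin d) → Prop} (h : ∀ᵐ t, p t) : ∀ᵐ t, p (t - x) :=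
  (measurePreserving_sub_right volume x).quasiMeasurePreserving.ae h

theorem timeFreqShift_zero {d : ℕ} (f : L2Space d) : timeFreqShift 0 f = f := by
  refine Lp.ext ?_
  filter_upwards [coeFn_timeFreqShift 0 f] with t ht
  simp [ht]

theorem timeFreqShift_add {d : ℕ} (z : PhaseSpace d) (f f' : L2Space d) :
    timeFreqShift z (f + f') = timeFreqShift z f + timeFreqShift z f' := by
  refine Lp.ext ?_
  filter_upwards [coeFn_timeFreqShift z (f + f'), coeFn_timeFreqShift z f,
    coeFn_timeFreqShift z f', ae_comp_sub_right z.1 (Lp.coeFn_add f f'),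
    Lp.coeFn_add (timeFreqShift z f) (timeFreqShift z f')] with t h1 h2 h3 h4 h5
  rw [h1, h5, Pi.add_apply, h2, h3, h4, Pi.add_apply, mul_add]

theorem timeFreqShift_smul {d : ℕ} (z : PhaseSpace d) (c : ℂ) (f : L2Space d) :
    timeFreqShift z (c • f) = c • timeFreqShift z f := by
  refine Lp.ext ?_
  filter_upwards [coeFn_timeFreqShift z (c • f), coeFn_timeFreqShift z f,
    ae_comp_sub_right z.1 (Lp.coeFn_smul c f),
    Lp.coeFn_smul c (timeFreqShift z f)] with t h1 h2 h3 h4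
  rw [h1, h4, Pi.smul_apply, h2, h3, Pi.smul_apply, smul_eq_mul, smul_eq_mul, mul_left_comm]

theorem norm_timeFreqShift {d : ℕ} (z : PhaseSpace d) (f : L2Space d) :
    ‖timeFreqShift z f‖ = ‖f‖ := by
  have h1 : ‖timeFreqShift z f‖ = ‖translation z.1 f‖ := by
    rw [Lp.norm_def, Lp.norm_def]
    congr 1
    refine eLpNorm_congr_norm_ae ?_
    have h : timeFreqShift z f =ᵐ[volume] _ :=
      (memLp_modulation z.2 (translation z.1 f)).coeFn_toLp
    filter_upwards [h] with t ht
    rw [ht]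
    simp [Complex.norm_exp]
  rw [h1, translation, Lp.norm_compMeasurePreserving]

/-- The phase factor relating `π(z) π(w)` to `π(z + w)`. -/
noncomputable def timeFreqPhase {d : ℕ} (z w : PhaseSpace d) : ℂ :=
  Complex.exp (-(2 * Real.pi * Complex.I * (inner ℝ w.2 z.1 : ℝ)))

theorem norm_timeFreqPhase {d : ℕ} (z w : PhaseSpace d) : ‖timeFreqPhase z w‖ = 1 := by
  simp [timeFreqPhase, Complex.norm_exp]

theorem timeFreqShift_timeFreqShift {d : ℕ} (z w : PhaseSpace d) (f : L2Space d) :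
    timeFreqShift z (timeFreqShift w f) = timeFreqPhase z w • timeFreqShift (z + w) f := by
  refine Lp.ext ?_
  filter_upwards [coeFn_timeFreqShift z (timeFreqShift w f), coeFn_timeFreqShift (z + w) f,
    ae_comp_sub_right z.1 (coeFn_timeFreqShift w f),
    Lp.coeFn_smul (timeFreqPhase z w) (timeFreqShift (z + w) f)] with t h1 h2 h3 h4
  rw [h1, h4, Pi.smul_apply, h2, h3, smul_eq_mul, timeFreqPhase, ← mul_assoc, ← mul_assoc,
    ← Complex.exp_add, ← Complex.exp_add, Prod.fst_add, Prod.snd_add, sub_sub, inner_sub_right,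
    inner_add_left]
  congr 2
  push_cast
  ring

/-- The time-frequency shift `π(z)` as a unitary operator. -/
noncomputable def timeFreqShiftEquiv {d : ℕ} (z : PhaseSpace d) : L2Space d ≃ₗᵢ[ℂ] L2Space d :=
  LinearIsometryEquiv.ofSurjective
    { toFun := timeFreqShift z
      map_add' := timeFreqShift_add z
      map_smul' := timeFreqShift_smul z
      norm_map' := norm_timeFreqShift z } fun f => by
    refine ⟨(timeFreqPhase z (-z))⁻¹ • timeFreqShift (-z) f, ?_⟩
    change timeFreqShift z _ = f
    have h : timeFreqPhase z (-z) ≠ 0 := by simp [timeFreqPhase]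
    rw [timeFreqShift_smul, timeFreqShift_timeFreqShift, smul_smul, inv_mul_cancel₀ h, one_smul,
      add_neg_cancel, timeFreqShift_zero]

@[simp]
theorem timeFreqShiftEquiv_apply {d : ℕ} (z : PhaseSpace d) (f : L2Space d) :
    timeFreqShiftEquiv z f = timeFreqShift z f := rfl

/-- The cocycle phase is unimodular, so under absolute values `π` behaves like a genuine
representation. -/
theorem norm_inner_timeFreqShift_add {d : ℕ} (z w : PhaseSpace d) (h f : L2Space d) :
    ‖(inner ℂ (timeFreqShift (z + w) h) f : ℂ)‖ =
      ‖(inner ℂ (timeFreqShift w h) ((timeFreqShiftEquiv z).symm f) : ℂ)‖ := by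
  rw [← (timeFreqShiftEquiv z).inner_map_map (timeFreqShift w h), LinearIsometryEquiv.apply_symm_apply,
    timeFreqShiftEquiv_apply, timeFreqShift_timeFreqShift, inner_smul_left, norm_mul,
    RCLike.norm_conj, norm_timeFreqPhase, one_mul]

/-! ### Plancherel and Moyal's identity. -/

open FourierTransform

/-- Paired with a test function `φ`, both sides equal `∫ 𝓕φ · k`: one by the distributional
definition, the other by Fubini. This makes Plancherel available for the Fourier integral. -/
theorem MeasureTheory.Lp.fourier_toLp_ae_eq {E : Type*} [NormedAddCommGroup E] [InnerProductSpace ℝ E]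
    [FiniteDimensional ℝ E] [MeasurableSpace E] [BorelSpace E] {k : E → ℂ}
    (h1 : Integrable k) (h2 : MemLp k 2) :
    (𝓕 (h2.toLp k) : Lp (α := E) ℂ 2) =ᵐ[volume] 𝓕 k := by
  refine ae_eq_of_integral_contDiff_smul_eq ((Lp.memLp _).locallyIntegrable (by norm_num)) ?_ ?_
  · refine Continuous.locallyIntegrable ?_
    exact VectorFourier.fourierIntegral_continuous Real.continuous_fourierChar
      (by exact continuous_inner) h1
  · intro φ hφ hc
    have hc' : HasCompactSupport (Complex.ofRealCLM ∘ φ) := hc.comp_left rfl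
    have hφ' : ContDiff ℝ (⊤ : ℕ∞) (Complex.ofRealCLM ∘ φ) := by fun_prop
    let ψ := hc'.toSchwartzMap hφ'
    have e1 := congrArg (fun T => T ψ) (Lp.fourier_toTemperedDistribution_eq (h2.toLp k))
    simp only [TemperedDistribution.fourier_apply, Lp.toTemperedDistribution_apply] at e1
    have e2 : ∫ ξ, 𝓕 (ψ : E → ℂ) ξ • k ξ = ∫ x, ψ x • 𝓕 k x := by
      have := VectorFourier.integral_fourierIntegral_smul_eq_flip (μ := (volume : Measure E))
        (ν := (volume : Measure E)) (L := innerₗ E)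
        Real.continuous_fourierChar (by exact continuous_inner) ψ.integrable h1
      rw [flip_innerₗ] at this
      exact this
    have e3 : ∫ x, (𝓕 ψ) x • (h2.toLp k) x = ∫ ξ, 𝓕 (ψ : E → ℂ) ξ • k ξ := by
      refine integral_congr_ae ?_
      filter_upwards [h2.coeFn_toLp] with x hx
      rw [hx, SchwartzMap.fourier_coe]
    rw [e3, e2] at e1
    simpa [ψ] using e1.symm

theorem lintegral_enorm_sq_eq_eLpNorm_sq {α : Type*} {m : MeasurableSpace α} {μ : Measure α}
    (f : α → ℂ) : ∫⁻ t, ‖f t‖ₑ ^ 2 ∂μ = eLpNorm f 2 μ ^ 2 := by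
  have := eLpNorm_nnreal_pow_eq_lintegral (p := 2) (f := f) (μ := μ) (by norm_num)
  simpa using this.symm

theorem lintegral_enorm_fourier_sq {E : Type*} [NormedAddCommGroup E] [InnerProductSpace ℝ E]
    [FiniteDimensional ℝ E] [MeasurableSpace E] [BorelSpace E] {k : E → ℂ}
    (h1 : Integrable k) (h2 : MemLp k 2) :
    ∫⁻ ω, ‖𝓕 k ω‖ₑ ^ 2 = ∫⁻ t, ‖k t‖ₑ ^ 2 := by
  rw [lintegral_enorm_sq_eq_eLpNorm_sq, lintegral_enorm_sq_eq_eLpNorm_sq,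
    ← eLpNorm_congr_ae (Lp.fourier_toLp_ae_eq h1 h2), ← eLpNorm_congr_ae h2.coeFn_toLp,
    ← Lp.enorm_def, ← Lp.enorm_def]
  congr 1
  rw [enorm_eq_iff_norm_eq, Lp.norm_fourier_eq]

theorem inner_timeFreqShift_eq_fourier {d : ℕ} (z : PhaseSpace d) (h f : L2Space d) :
    (inner ℂ (timeFreqShift z h) f : ℂ) =
      𝓕 (fun t => (starRingEnd ℂ) (h (t - z.1)) * f t) z.2 := by
  rw [L2.inner_def, Real.fourier_eq']
  refine integral_congr_ae ?_
  filter_upwards [coeFn_timeFreqShift z h] with t ht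
  rw [ht, RCLike.inner_apply, map_mul, ← Complex.exp_conj, smul_eq_mul, real_inner_comm]
  simp only [map_mul, Complex.conj_ofReal, Complex.conj_I, map_ofNat, Complex.ofReal_mul,
    Complex.ofReal_neg, Complex.ofReal_ofNat]
  ring_nf

theorem measurable_inner_timeFreqShift {d : ℕ} (h f : L2Space d) :
    Measurable fun z : PhaseSpace d => (inner ℂ (timeFreqShift z h) f : ℂ) := by
  simp only [inner_timeFreqShift_eq_fourier, Real.fourier_eq', smul_eq_mul]
  have hh := (Lp.stronglyMeasurable h).measurable
  have hf := (Lp.stronglyMeasurable f).measurable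
  refine (StronglyMeasurable.integral_prod_right' (f := fun p : PhaseSpace d ×
    EuclideanSpace ℝ (Fin d) => Complex.exp (((-2 * Real.pi * inner ℝ p.2 p.1.2 : ℝ) : ℂ) *
      Complex.I) * ((starRingEnd ℂ) (h (p.2 - p.1.1)) * f p.2)) ?_).measurable
  refine Measurable.stronglyMeasurable (Measurable.mul (by fun_prop) (Measurable.mul ?_ (by fun_prop)))
  exact RCLike.continuous_conj.measurable.comp (hh.comp (by fun_prop))

/-- The orthogonality relation for the short-time Fourier transform of a bounded function. -/
theorem lintegral_enorm_inner_timeFreqShift_sq {d : ℕ} (h f : L2Space d)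
    (hf : MemLp f ⊤ (volume : Measure (EuclideanSpace ℝ (Fin d)))) :
    ∫⁻ z : PhaseSpace d, ‖(inner ℂ (timeFreqShift z h) f : ℂ)‖ₑ ^ 2 = ‖h‖ₑ ^ 2 * ‖f‖ₑ ^ 2 := by
  have hhm := (Lp.stronglyMeasurable h).measurable
  have hfm := (Lp.stronglyMeasurable f).measurable
  have htrans (x : EuclideanSpace ℝ (Fin d)) :
      MemLp (fun t => (starRingEnd ℂ) (h (t - x))) 2 volume :=
    ((Lp.memLp h).comp_measurePreserving (measurePreserving_sub_right volume x)).star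
  have hfiber (x : EuclideanSpace ℝ (Fin d)) :
      ∫⁻ ω, ‖(inner ℂ (timeFreqShift (x, ω) h) f : ℂ)‖ₑ ^ 2 =
        ∫⁻ t, ‖h (t - x)‖ₑ ^ 2 * ‖f t‖ₑ ^ 2 := by
    -- Boundedness of `f` puts the product in `L¹ ∩ L²`, so Plancherel applies for every `x`.
    simp only [inner_timeFreqShift_eq_fourier]
    refine (lintegral_enorm_fourier_sq ((htrans x).integrable_mul (Lp.memLp f)) (hf.mul' (htrans x))).trans
      (lintegral_congr fun t => ?_)
    rw [Pi.mul_apply, enorm_mul, mul_pow, RCLike.enorm_conj]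
  rw [Measure.volume_eq_prod, lintegral_prod _
    ((measurable_inner_timeFreqShift h f).enorm.pow_const 2).aemeasurable]
  simp only [hfiber]
  rw [lintegral_lintegral_swap (by fun_prop)]
  have hx (t : EuclideanSpace ℝ (Fin d)) :
      ∫⁻ x, ‖h (t - x)‖ₑ ^ 2 * ‖f t‖ₑ ^ 2 = ‖h‖ₑ ^ 2 * ‖f t‖ₑ ^ 2 := by
    rw [lintegral_mul_const _ (by fun_prop), lintegral_sub_left_eq_self (fun x => ‖h x‖ₑ ^ 2) t,
      lintegral_enorm_sq_eq_eLpNorm_sq, ← Lp.enorm_def]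
  simp only [hx]
  rw [lintegral_const_mul _ (by fun_prop), lintegral_enorm_sq_eq_eLpNorm_sq, ← Lp.enorm_def]

theorem exists_ne_zero_memLp_top (d : ℕ) :
    ∃ f : L2Space d, f ≠ 0 ∧ MemLp f ⊤ (volume : Measure (EuclideanSpace ℝ (Fin d))) := by
  have hfin : volume (Metric.ball (0 : EuclideanSpace ℝ (Fin d)) 1) ≠ ⊤ := measure_ball_lt_top.ne
  refine ⟨indicatorConstLp 2 measurableSet_ball hfin (1 : ℂ), fun h0 => ?_, ?_⟩
  · have := norm_indicatorConstLp (E := ℂ) (p := 2) (c := 1) (hs := measurableSet_ball)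
      (hμs := hfin) (by norm_num) (by norm_num)
    rw [h0, norm_zero, norm_one, one_mul] at this
    have hpos : 0 < (volume : Measure (EuclideanSpace ℝ (Fin d))).real (Metric.ball 0 1) :=
      ENNReal.toReal_pos (Metric.measure_ball_pos volume 0 one_pos).ne' hfin
    exact (Real.rpow_pos_of_pos hpos _).ne this
  · exact (memLp_congr_ae indicatorConstLp_coeFn).2
      (memLp_indicator_const ⊤ measurableSet_ball 1 (Or.inr hfin))

/-! ### Periodization over the lattice. -/

instance isAddHaarMeasure_volume_phaseSpace (d : ℕ) :
    (volume : Measure (PhaseSpace d)).IsAddHaarMeasure :=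
  inferInstanceAs (Measure.prod volume volume).IsAddHaarMeasure

/-- If `π(λ) h`, `λ ∈ Λ`, is a tight frame with constant `1`, then `‖h‖ ^ 2` is the volume of a
fundamental domain of `Λ`. -/
theorem volume_fundamentalDomain_eq_of_hasSum {d : ℕ} (h : L2Space d)
    (Λ : Submodule ℤ (PhaseSpace d)) [DiscreteTopology Λ] [IsZLattice ℝ Λ]
    {F : Set (PhaseSpace d)}
    (hF : IsAddFundamentalDomain Λ F volume)
    (hsum : ∀ f, HasSum (fun γ : Λ => ‖(inner ℂ (timeFreqShift (γ : PhaseSpace d) h) f : ℂ)‖ ^ 2)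
      (‖f‖ ^ 2)) :
    volume F = ‖h‖ₑ ^ 2 := by
  obtain ⟨f, hf0, hf⟩ := exists_ne_zero_memLp_top d
  have hinv : MeasurableVAdd Λ (PhaseSpace d) :=
    (inferInstance : MeasurableVAdd Λ.toAddSubgroup (PhaseSpace d))
  have hinv' : VAddInvariantMeasure Λ (PhaseSpace d) volume :=
    (inferInstance : VAddInvariantMeasure Λ.toAddSubgroup (PhaseSpace d) volume)
  have hsum' (f : L2Space d) :
      ∑' γ : Λ, ‖(inner ℂ (timeFreqShift (γ : PhaseSpace d) h) f : ℂ)‖ₑ ^ 2 = ‖f‖ₑ ^ 2 := by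
    have := hsum f
    simp only [← ofReal_norm, ← ENNReal.ofReal_pow (norm_nonneg _)]
    rw [← ENNReal.ofReal_tsum_of_nonneg (fun _ => by positivity) this.summable, this.tsum_eq]
  have hmoyal := lintegral_enorm_inner_timeFreqShift_sq h f hf
  have hmeas (γ : Λ) : AEMeasurable (fun z : PhaseSpace d =>
      ‖(inner ℂ (timeFreqShift (γ +ᵥ z) h) f : ℂ)‖ₑ ^ 2) (volume.restrict F) :=
    (((measurable_inner_timeFreqShift h f).comp (measurable_const_vadd γ)).enorm.pow_const
      2).aemeasurable
  rw [hF.lintegral_eq_tsum'', ← lintegral_tsum hmeas] at hmoyal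
  -- Up to phases, the sum at `z` is the Parseval sum of `π(z)⁻¹ f`, and `π(z)` is unitary.
  have hpoint (z : PhaseSpace d) :
      ∑' γ : Λ, ‖(inner ℂ (timeFreqShift (γ +ᵥ z) h) f : ℂ)‖ₑ ^ 2 = ‖f‖ₑ ^ 2 := by
    rw [← (timeFreqShiftEquiv z).symm.enorm_map f, ← hsum']
    refine tsum_congr fun γ => ?_
    rw [Submodule.vadd_def, vadd_eq_add, add_comm, ← ofReal_norm, norm_inner_timeFreqShift_add,
      ofReal_norm]
  simp only [hpoint, lintegral_const, Measure.restrict_apply_univ] at hmoyal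
  rw [mul_comm] at hmoyal
  exact (ENNReal.mul_left_inj (by simpa using hf0) (by simp)).1 hmoyal

/-- Translation by `w` permutes `Λ`; this is the invariance that makes the tightening operator
commute with lattice shifts. -/
theorem tsum_inner_gaborSystem_timeFreqShift {d : ℕ} (g : L2Space d)
    (Λ : Submodule ℤ (PhaseSpace d)) (w : Λ) (f : L2Space d) :
    ∑' γ, ‖(inner ℂ (gaborSystem g (Λ : Set (PhaseSpace d)) γ)
        (timeFreqShiftEquiv (w : PhaseSpace d) f) : ℂ)‖ ^ 2 =
      ∑' γ, ‖(inner ℂ (gaborSystem g (Λ : Set (PhaseSpace d)) γ) f : ℂ)‖ ^ 2 := by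
  refine ((Equiv.addLeft w).tsum_eq (fun γ : Λ => ‖(inner ℂ (timeFreqShift (γ : PhaseSpace d) g)
        (timeFreqShiftEquiv (w : PhaseSpace d) f) : ℂ)‖ ^ 2)).symm.trans (tsum_congr fun γ => ?_)
  rw [Equiv.coe_addLeft, Submodule.coe_add, norm_inner_timeFreqShift_add,
    LinearIsometryEquiv.symm_apply_apply]
  rfl

/-- Here `Λ` is a full-rank lattice in `ℝ^{2d}` (a discrete subgroup spanning `ℝ^{2d}`), and
`ZLattice.covolume Λ` is the Lebesgue measure of a fundamental domain, that is `|det M|` for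
`Λ = M ℤ^{2d}`. -/
theorem mainTheorem8 (d : ℕ) (g : L2Space d) (Λ : Submodule ℤ (PhaseSpace d))
    [DiscreteTopology Λ] [IsZLattice ℝ Λ]
    (hframe : IsFrame (gaborSystem g (Λ : Set (PhaseSpace d)))) :
    ZLattice.covolume Λ volume ≤ 1 := by
  obtain ⟨R, hR, hcomm⟩ := hframe.exists_tightening
  have hshift (γ : Λ) (f : L2Space d) :
      R (timeFreqShift (γ : PhaseSpace d) f) = timeFreqShift (γ : PhaseSpace d) (R f) :=
    hcomm (timeFreqShiftEquiv (γ : PhaseSpace d))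
      (tsum_inner_gaborSystem_timeFreqShift g Λ γ) f
  have hsum (f : L2Space d) : HasSum (fun γ : Λ =>
      ‖(inner ℂ (timeFreqShift (γ : PhaseSpace d) (R g)) f : ℂ)‖ ^ 2) (‖f‖ ^ 2) := by
    simp only [← hshift]
    exact hR f
  have hle : ‖R g‖ ≤ 1 := by
    -- Keep only the term `λ = 0` of the Parseval sum.
    have h0 := le_hasSum (hsum (R g)) 0 fun _ _ => by positivity
    rw [Submodule.coe_zero, timeFreqShift_zero, inner_self_eq_norm_sq_to_K, norm_pow,
      RCLike.norm_ofReal, abs_norm] at h0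
    by_contra! hlt
    nlinarith [mul_pos (sub_pos.2 hlt) (sub_pos.2 hlt)]
  have hF := ZLattice.isAddFundamentalDomain (Module.Free.chooseBasis ℤ Λ)
    (volume : Measure (PhaseSpace d))
  rw [ZLattice.covolume_eq_measure_fundamentalDomain Λ volume hF, Measure.real,
    volume_fundamentalDomain_eq_of_hasSum (R g) Λ hF hsum, ENNReal.toReal_pow, toReal_enorm]
  exact pow_le_one₀ (norm_nonneg _) hle
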